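/- Notation. $\dim_{\mathrm H}$ is Hausdorff dimension and $\mathcal H^\alpha$ is (outer) Hausdorff measure. $\mathcal A(n,m)$ is the set of affine $m$-planes of $\mathbb R^n$ with the metric $\|P_W-P_{W'}\|+|a_W-a_{W'}|$, where $P_W$ is the orthogonal projection onto the direction of $W$, $\|\cdot\|$ is the operator norm and $a_W$ is the point of $W$ closest to the origin. For a subset $A$ of a metric space $X$, a function $f\ge 0$ and $\alpha\ge 0$, define $$\operatorname*{ess\,sup}^{\alpha}_{x\in A} f(x)=\sup\{q\ge 0:\mathcal H^\alpha(\{x\in A: f(x)>q\})>0\}\quad(\sup\emptyset=0)$$ if $\mathcal H^\alpha(A)>0$. If $\mathcal H^\alpha(A)=0$, define it as the limit of the same supremum with $\alpha-\varepsilon$ in place of $\alpha$, as $\varepsilon\to0^+$. A nonempty set $B\subset X\times Y$, with projection $\pi_X$ to $X$, has the Fubini property if, with $\alpha=\dim_{\mathrm H}\pi_X(B)$, $$\dim_{\mathrm H}B=\dim_{\mathrm H}\pi_X(B)+\operatorname*{ess\,sup}^{\alpha}_{x\in\pi_X(B)}\dim_{\mathrm H}(\pi_X^{-1}(x)\cap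 B).$$ For $E\subset\mathbb R^d$ let $\mathcal P^k(E)\subset\mathcal A(d,k)$ be the set of $k$-planes spanned by $k+1$ affinely independent points of $E$, and let $$\mathcal S=\{(\operatorname{aff}\{x_0,\dots,x_k\},(x_0,\dots,x_k)):x_0,\dots,x_k\in E\text{ affinely independent}\}\subset\mathcal A(d,k)\times\mathbb R^{d(k+1)},$$ $$\mathcal W^{k+1}(E)=\{W^{k+1}: W\in\mathcal P^k(E)\}\subset\mathcal A(d(k+1),k(k+1)).$$ Theorem. Let $1\le k\le d-1$ be integers, let $s$ be a real number and let $E\subset\mathbb R^d$ be a Borel set with $\dim_{\mathrm H}E>s>k$. Assume that (1) the set $\mathcal S$ has the Fubini property (with respect to the projection to $\mathcal A(d,k)$); (2) with $\beta=\dim_{\mathrm H}\mathcal P^k(E)$, $$\operatorname*{ess\,sup}^{\beta}_{Z\in\mathcal W^{k+1}(E)}\dim_{\mathrm H}(E^{k+1}\cap Z)\le\max\{0,\dim_{\mathrm H}(E^{k+1})-(k+1)(d-k)\}.$$ Then $$\dim_{\mathrm H}\mathcal P^k(E)\ge(k+1)\min\{s,d-k\}.$$ -/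

import Mathlib

open Set Filter Topology MeasureTheory
open scoped ENNReal NNReal

noncomputable section

section EssSup

variable {X : Type*} [MetricSpace X] [MeasurableSpace X] [BorelSpace X]

/-- `sup {q ≥ 0 : ℋ^α ({x ∈ A : f x > q}) > 0}`, with `sup ∅ = 0`. On arbitrary sets `μH[α]` is the
(outer) `α`-dimensional Hausdorff measure. -/
def preEssSup (α : ℝ) (A : Set X) (f : X → ℝ≥0∞) : ℝ≥0∞ :=
  ⨆ (q : ℝ≥0) (_ : 0 < μH[α] {x ∈ A | (q : ℝ≥0∞) < f x}), (q : ℝ≥0∞)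

open Classical in
/-- The `α`-essential supremum of `f` over `A`: it is `preEssSup α A f` if `ℋ^α(A) > 0`, and the limit
of `preEssSup (α - ε) A f` as `ε → 0+` if `ℋ^α(A) = 0`. -/
def hausdorffEssSup (α : ℝ) (A : Set X) (f : X → ℝ≥0∞) : ℝ≥0∞ :=
  if 0 < μH[α] A then preEssSup α A f
  else limUnder (𝓝[>] (0 : ℝ)) fun ε => preEssSup (α - ε) A f

theorem preEssSup_monotone (α : ℝ) (A : Set X) (f : X → ℝ≥0∞) :
    Monotone fun ε : ℝ => preEssSup (α - ε) A f := by
  intro ε₁ ε₂ h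
  refine iSup_mono fun q => iSup_mono' fun hq => ⟨?_, le_rfl⟩
  exact hq.trans_le (Measure.hausdorffMeasure_mono (by linarith) _)

/-- The limit in the definition of `hausdorffEssSup` always exists. -/
theorem tendsto_preEssSup (α : ℝ) (A : Set X) (f : X → ℝ≥0∞) :
    Tendsto (fun ε : ℝ => preEssSup (α - ε) A f) (𝓝[>] 0)
      (𝓝 (limUnder (𝓝[>] (0 : ℝ)) fun ε => preEssSup (α - ε) A f)) :=
  tendsto_nhds_limUnder ⟨_, (preEssSup_monotone α A f).tendsto_nhdsGT 0⟩

/-- The Fubini property of a nonempty set `B ⊆ X × Y` (with respect to the projection to `X`), for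
`X`, `Y` of finite Hausdorff dimension. The product carries the maximum metric, which is
bi-Lipschitz equivalent to the Euclidean product metric. -/
def FubiniProperty {Y : Type*} [MetricSpace Y] (B : Set (X × Y)) : Prop :=
  B.Nonempty ∧
    dimH B = dimH (Prod.fst '' B) +
      hausdorffEssSup (dimH (Prod.fst '' B)).toReal (Prod.fst '' B)
        fun x => dimH (Prod.fst ⁻¹' {x} ∩ B)

end EssSup

/-- The affine Grassmannian: nonempty affine subspaces of dimension `k` of a Euclidean space `V`. -/
structure AffineGrassmannian (V : Type*) [NormedAddCommGroup V] [InnerProductSpace ℝ V]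
    [FiniteDimensional ℝ V] (k : ℕ) where
  plane : AffineSubspace ℝ V
  nonempty : (plane : Set V).Nonempty
  finrank_direction : Module.finrank ℝ plane.direction = k

namespace AffineGrassmannian

variable {V : Type*} [NormedAddCommGroup V] [InnerProductSpace ℝ V] [FiniteDimensional ℝ V] {k : ℕ}

instance (W : AffineGrassmannian V k) : Nonempty W.plane := W.nonempty.to_subtype

/-- Orthogonal projection of `V` onto the direction of `W`. -/
def proj (W : AffineGrassmannian V k) : V →L[ℝ] V := W.plane.direction.starProjection

/-- The point of `W` closest to the origin, i.e. the point of `W` orthogonal to its direction. -/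
def foot (W : AffineGrassmannian V k) : V := (EuclideanGeometry.orthogonalProjection W.plane 0 : V)

/-- The natural metric `‖P_W - P_{W'}‖ + |a_W - a_{W'}|`, where `P_W` is the orthogonal projection onto
the direction of `W`, `‖·‖` is the operator norm, and `a_W` is the foot point of `W`. -/
instance : MetricSpace (AffineGrassmannian V k) where
  dist W W' := ‖W.proj - W'.proj‖ + ‖W.foot - W'.foot‖
  dist_self W := by simp
  dist_comm W W' := by simp only [norm_sub_rev]
  dist_triangle W₁ W₂ W₃ := by
    have h₁ := norm_sub_le_norm_sub_add_norm_sub W₁.proj W₂.proj W₃.proj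
    have h₂ := norm_sub_le_norm_sub_add_norm_sub W₁.foot W₂.foot W₃.foot
    linarith
  eq_of_dist_eq_zero := by
    intro W W' h
    have h₁ : ‖W.proj - W'.proj‖ = 0 := by
      linarith [norm_nonneg (W.proj - W'.proj), norm_nonneg (W.foot - W'.foot)]
    have h₂ : ‖W.foot - W'.foot‖ = 0 := by
      linarith [norm_nonneg (W.proj - W'.proj), norm_nonneg (W.foot - W'.foot)]
    rw [norm_eq_zero, sub_eq_zero] at h₁ h₂
    have hd : W.plane.direction = W'.plane.direction := Submodule.starProjection_inj.1 h₁
    have hp : W.plane = W'.plane := by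
      refine AffineSubspace.ext_of_direction_eq hd ⟨W.foot, ?_, ?_⟩
      · exact EuclideanGeometry.orthogonalProjection_mem _
      · rw [h₂]
        exact EuclideanGeometry.orthogonalProjection_mem _
    cases W
    cases W'
    simp_all

instance : MeasurableSpace (AffineGrassmannian V k) := borel _

instance : BorelSpace (AffineGrassmannian V k) := ⟨rfl⟩

/-- The affine plane `aff {x₀, …, x_k}` spanned by affinely independent points. -/
def span (x : Fin (k + 1) → V) (hx : AffineIndependent ℝ x) : AffineGrassmannian V k where
  plane := affineSpan ℝ (range x)
  nonempty := (range_nonempty x).mono (subset_affineSpan ℝ _)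
  finrank_direction := by
    rw [direction_affineSpan]
    exact hx.finrank_vectorSpan (by simp)

/-- The plane `W^n = W × ⋯ × W` in `V^n`. -/
def powPlane (W : AffineSubspace ℝ V) (n : ℕ) : AffineSubspace ℝ (PiLp 2 fun _ : Fin n => V) where
  carrier := {x | ∀ i, x i ∈ W}
  smul_vsub_vadd_mem' c {_ _ _} h₁ h₂ h₃ i := W.smul_vsub_vadd_mem c (h₁ i) (h₂ i) (h₃ i)

theorem mem_direction_powPlane {V : Type*} [NormedAddCommGroup V] [InnerProductSpace ℝ V] {W : AffineSubspace ℝ V} (hW : (W : Set V).Nonempty) {n : ℕ}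
    (v : PiLp 2 fun _ : Fin n => V) :
    v ∈ (powPlane W n).direction ↔ ∀ i, v i ∈ W.direction := by
  obtain ⟨a, ha⟩ := hW
  have hb : WithLp.toLp 2 (fun _ : Fin n => a) ∈ powPlane W n := fun _ => ha
  rw [← AffineSubspace.vadd_mem_iff_mem_direction v hb]
  change (∀ i, v i +ᵥ a ∈ W) ↔ _
  simp only [AffineSubspace.vadd_mem_iff_mem_direction _ ha]

/-- The map `W ↦ W^n`, from `A(V, k)` to `A(V^n, n k)`. -/
def pow (W : AffineGrassmannian V k) (n : ℕ) :
    AffineGrassmannian (PiLp 2 fun _ : Fin n => V) (n * k) where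
  plane := powPlane W.plane n
  nonempty := ⟨WithLp.toLp 2 fun _ => W.nonempty.some, fun _ => W.nonempty.some_mem⟩
  finrank_direction := by
    let e : (powPlane W.plane n).direction ≃ₗ[ℝ] (Fin n → W.plane.direction) :=
      { toFun := fun v i => ⟨v.1 i, (mem_direction_powPlane W.nonempty v.1).1 v.2 i⟩
        invFun := fun u => ⟨WithLp.toLp 2 fun i => (u i : V),
          (mem_direction_powPlane W.nonempty _).2 fun i => (u i).2⟩
        map_add' := fun _ _ => rfl
        map_smul' := fun _ _ => rfl
        left_inv := fun _ => rfl
        right_inv := fun _ => rfl }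
    rw [e.finrank_eq, Module.finrank_pi_fintype]
    simp [W.finrank_direction]

end AffineGrassmannian

/-- `ℝ^d` with the Euclidean norm. -/
abbrev Euc (d : ℕ) : Type := EuclideanSpace ℝ (Fin d)

/-- `ℝ^{d n} = (ℝ^d)^n` with the Euclidean norm. -/
abbrev EucPow (d n : ℕ) : Type := PiLp 2 fun _ : Fin n => Euc d

/-- The Cartesian power `E^n`. -/
def powSet {d : ℕ} (E : Set (Euc d)) (n : ℕ) : Set (EucPow d n) := {x | ∀ i, x i ∈ E}

/-- `𝒫^k(E)`: the `k`-planes spanned by `k + 1` affinely independent points of `E`. -/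
def spannedPlanes {d : ℕ} (E : Set (Euc d)) (k : ℕ) : Set (AffineGrassmannian (Euc d) k) :=
  {W | ∃ (x : EucPow d (k + 1)) (hx : AffineIndependent ℝ x.ofLp),
    x ∈ powSet E (k + 1) ∧ W = AffineGrassmannian.span x.ofLp hx}

/-- The incidence set `{(aff(x), x) : x ∈ E^{k+1} affinely independent}`. -/
def incidenceSet {d : ℕ} (E : Set (Euc d)) (k : ℕ) :
    Set (AffineGrassmannian (Euc d) k × EucPow d (k + 1)) :=
  {p | ∃ (x : EucPow d (k + 1)) (hx : AffineIndependent ℝ x.ofLp),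
    x ∈ powSet E (k + 1) ∧ p = (AffineGrassmannian.span x.ofLp hx, x)}

/-- `𝒲^{k+1}(E) = {W^{k+1} : W ∈ 𝒫^k(E)}`, a subset of `A(d(k+1), k(k+1))`. -/
def diagonalPlanes {d : ℕ} (E : Set (Euc d)) (k : ℕ) :
    Set (AffineGrassmannian (EucPow d (k + 1)) ((k + 1) * k)) :=
  (fun W => W.pow (k + 1)) '' spannedPlanes E k

end

/-!
Write `D = dim E^{k+1}` and `β = dim 𝒫^k(E)`. The Fubini property of the incidence set `𝒮` reads
`dim 𝒮 = β + ess sup_W dim 𝒮_W`, and the fibre `𝒮_W` lies in `{W} × (E^{k+1} ∩ W^{k+1})`. As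
`W ↦ W^{k+1}` is bi-Lipschitz (`AffineGrassmannian.lipschitzWith_pow`,
`AffineGrassmannian.antilipschitzWith_pow`), the essential supremum over `W` is at most the one over the
planes `W^{k+1}` (`hausdorffEssSup_le_image`), so the slice hypothesis gives
`dim 𝒮 ≤ β + max {0, D - (k+1)(d-k)}`.

On the other side `dim 𝒮 ≥ D`: the projection of `𝒮` to the second factor consists of the affinely
independent tuples in `E^{k+1}`, and these have full dimension `D` because `dim E > k`
(`dimH_affineIndependent_eq`). Either the maximum is `0`, and then `β ≥ D ≥ (k+1) dim E`, or `D` cancels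
and `β ≥ (k+1)(d-k)`.

Both `D ≥ (k+1) dim E` and the statement on independent tuples rest on the product inequality
`dim A + dim B ≤ dim (A × B)`, and the latter also on `dim (A × ℝ^k) ≤ dim A + k`. These are obtained,
for arbitrary sets and without Frostman measures, from weighted covers by dyadic cubes. Contents defined by
weighted covers are supermultiplicative for trivial reasons (`DyadicNet.mul_weightedContent_le`), and
choosing a random threshold turns a weighted cover into a genuine cover that costs no more
(`DyadicNet.exists_cover_of_weight`), so that the weighted content has the null sets of Hausdorff measure.
-/

/-! ### Dyadic partitions -/

/-- A nested sequence of partitions of `X` into cells of diameter at most `2⁻ⁿ`, such that every set of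
diameter at most `2⁻ⁿ` meets a bounded number of cells of level `n`. The partition of level `n` is
encoded by its labelling `cell n : X → J`; labels of different levels are unrelated. -/
structure DyadicNet (X : Type*) [PseudoEMetricSpace X] (J : Type*) where
  cell : ℕ → X → J
  nested : ∀ n x y, cell (n + 1) x = cell (n + 1) y → cell n x = cell n y
  edist_le : ∀ n x y, cell n x = cell n y → edist x y ≤ 2⁻¹ ^ n
  multiplicity : ℕ
  encard_image_le : ∀ n T, Metric.ediam T ≤ 2⁻¹ ^ n → (cell n '' T).encard ≤ multiplicity

namespace DyadicNet

/-! ### Weighted dyadic contents and Hausdorff measure -/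

section Content

variable {X J : Type*} [EMetricSpace X] (N : DyadicNet X J)

/-- The infimum of `∑ w(Q) 2^{-ns}` (`n` the level of the cell `Q`) over all weights `w ≥ 0` on cells
whose total over the cells containing `x` is at least `1`, for each `x ∈ A`. Genuine covers
are the weights with values in `{0, 1}`. Cells of every level `n ≥ 0` are allowed, so this is a
content and not a measure; it has the same null sets as `μH[s]` if `s > 0` and `J` is countable. -/
noncomputable def weightedContent (s : ℝ) (A : Set X) : ℝ≥0∞ :=
  ⨅ (w : ℕ → J → ℝ≥0∞) (_ : ∀ x ∈ A, 1 ≤ ∑' n, w n (N.cell n x)),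
    ∑' n, ∑' j, w n j * (2⁻¹ ^ n) ^ s

variable {N} {s : ℝ} {A : Set X}

theorem weightedContent_le (w : ℕ → J → ℝ≥0∞) (hw : ∀ x ∈ A, 1 ≤ ∑' n, w n (N.cell n x)) :
    N.weightedContent s A ≤ ∑' n, ∑' j, w n j * (2⁻¹ ^ n) ^ s :=
  iInf₂_le w hw

theorem exists_weight_of_weightedContent_lt {c : ℝ≥0∞} (h : N.weightedContent s A < c) :
    ∃ w : ℕ → J → ℝ≥0∞, (∀ x ∈ A, 1 ≤ ∑' n, w n (N.cell n x)) ∧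
      ∑' n, ∑' j, w n j * (2⁻¹ ^ n) ^ s < c := by
  simpa only [weightedContent, iInf_lt_iff, exists_prop] using h

theorem weightedContent_mono {B : Set X} (h : A ⊆ B) :
    N.weightedContent s A ≤ N.weightedContent s B :=
  le_iInf₂ fun w hw => weightedContent_le w fun x hx => hw x (h hx)

theorem weightedContent_empty : N.weightedContent s ∅ = 0 := by
  simpa using weightedContent_le (N := N) (s := s) (A := ∅) (fun _ _ => 0) (by simp)

/-- Weighted covers of the pieces add up to a weighted cover of the union. -/
theorem weightedContent_iUnion_le (T : ℕ → Set X) :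
    N.weightedContent s (⋃ i, T i) ≤ ∑' i, N.weightedContent s (T i) := by
  refine ENNReal.le_of_forall_pos_le_add fun ε hε hfin => ?_
  obtain ⟨δ, hδ, hsum⟩ := ENNReal.exists_pos_sum_of_countable (ENNReal.coe_pos.2 hε).ne' ℕ
  have hlt : ∀ i, N.weightedContent s (T i) < N.weightedContent s (T i) + δ i := fun i =>
    ENNReal.lt_add_right (ne_top_of_le_ne_top hfin.ne (ENNReal.le_tsum i))
      (ENNReal.coe_pos.2 (hδ i)).ne'
  choose w hw hcost using fun i => exists_weight_of_weightedContent_lt (hlt i)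
  refine (weightedContent_le (fun n j => ∑' i, w i n j) fun x hx => ?_).trans ?_
  · obtain ⟨i, hi⟩ := mem_iUnion.1 hx
    exact (hw i x hi).trans (ENNReal.tsum_le_tsum fun n =>
      ENNReal.le_tsum (f := fun i => w i n (N.cell n x)) i)
  · calc ∑' n, ∑' j, (∑' i, w i n j) * (2⁻¹ ^ n) ^ s
        = ∑' i, ∑' n, ∑' j, w i n j * (2⁻¹ ^ n) ^ s := by
          simp_rw [← ENNReal.tsum_mul_right]
          exact (tsum_congr fun n => ENNReal.tsum_comm).trans ENNReal.tsum_comm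
      _ ≤ ∑' i, (N.weightedContent s (T i) + δ i) := ENNReal.tsum_le_tsum fun i => (hcost i).le
      _ ≤ _ := by
          rw [ENNReal.tsum_add]
          gcongr

theorem weightedContent_le_of_ediam_le {T : Set X} {n : ℕ} (h : Metric.ediam T ≤ 2⁻¹ ^ n) :
    N.weightedContent s T ≤ N.multiplicity * (2⁻¹ ^ n) ^ s := by
  classical
  refine (weightedContent_le (fun m j => if m = n then (N.cell n '' T).indicator 1 j else 0)
    fun x hx => ?_).trans ?_
  · refine le_trans ?_ (ENNReal.le_tsum n)
    simp [indicator_of_mem (mem_image_of_mem (N.cell n) hx)]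
  · rw [tsum_eq_single n (by simp +contextual)]
    simp only [if_true, ENNReal.tsum_mul_right]
    gcongr
    rw [← tsum_subtype]
    simp only [Pi.one_apply, ENNReal.tsum_set_one]
    exact_mod_cast N.encard_image_le n T h

theorem tendsto_dyadic_rpow (hs : 0 < s) :
    Tendsto (fun n : ℕ => ((2 : ℝ≥0∞)⁻¹ ^ n) ^ s) atTop (𝓝 0) := by
  have h := ENNReal.tendsto_pow_atTop_nhds_zero_of_lt_one (r := 2⁻¹) (by simp)
  simpa [hs] using h.ennrpow_const s

theorem weightedContent_le_ediam {T : Set X} (hs : 0 < s) (h : Metric.ediam T ≤ 1) :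
    N.weightedContent s T ≤ N.multiplicity * 2 ^ s * Metric.ediam T ^ s := by
  have hlim := ENNReal.tendsto_pow_atTop_nhds_zero_of_lt_one (r := 2⁻¹) (by simp)
  rcases eq_or_ne (Metric.ediam T) 0 with h0 | h0
  · have hle : ∀ n : ℕ, N.weightedContent s T ≤ N.multiplicity * (2⁻¹ ^ n) ^ s := fun n =>
      weightedContent_le_of_ediam_le (by simp [h0])
    have := ge_of_tendsto' (ENNReal.Tendsto.const_mul (tendsto_dyadic_rpow hs)
      (Or.inr (ENNReal.natCast_ne_top N.multiplicity))) hle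
    rw [mul_zero] at this
    exact this.trans zero_le
  · classical
    have hex : ∃ n : ℕ, (2 : ℝ≥0∞)⁻¹ ^ n < Metric.ediam T :=
      (hlim.eventually_lt_const (pos_iff_ne_zero.2 h0)).exists
    obtain ⟨m, hm⟩ : ∃ m, Nat.find hex = m + 1 := by
      refine Nat.exists_eq_succ_of_ne_zero fun h0 => ?_
      have := Nat.find_spec hex
      rw [h0, pow_zero] at this
      exact absurd h this.not_ge
    have h1 : (2 : ℝ≥0∞)⁻¹ ^ (m + 1) < Metric.ediam T := hm ▸ Nat.find_spec hex
    have h2 : Metric.ediam T ≤ 2⁻¹ ^ m := not_lt.1 (Nat.find_min hex (by omega))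
    refine (weightedContent_le_of_ediam_le h2).trans ?_
    rw [mul_assoc, ← ENNReal.mul_rpow_of_nonneg _ _ hs.le]
    gcongr
    calc (2 : ℝ≥0∞)⁻¹ ^ m = 2 * 2⁻¹ ^ (m + 1) := by
          rw [pow_succ', ← mul_assoc, ENNReal.mul_inv_cancel (by simp) (by simp), one_mul]
      _ ≤ _ := by gcongr

/-- A weighted cover dominates the cost of a genuine cover. For a threshold `θ ∈ [0, 1)`, the cells at
which the weight accumulated from level `0` down to the cell first exceeds `θ` cover `A`. A cell is selected
for a set of `θ` of length at most its weight, so the expected cost of this cover, for uniform `θ`, is at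
most the cost of the weights. -/
theorem exists_cover_of_weight [Countable J] {w : ℕ → J → ℝ≥0∞}
    (hw : ∀ x ∈ A, 1 ≤ ∑' n, w n (N.cell n x)) :
    ∃ C : Set (ℕ × J), (∀ x ∈ A, ∃ n, (n, N.cell n x) ∈ C) ∧
      ∑' p : ℕ × J, C.indicator (fun p => ((2 : ℝ≥0∞)⁻¹ ^ p.1) ^ s) p ≤
        ∑' n, ∑' j, w n j * (2⁻¹ ^ n) ^ s := by
  classical
  -- The total weight of the cells around `x` of level less than `n`; it depends on `cell n x` only.
  set a : ℕ → X → ℝ≥0∞ := fun n x => ∑ m ∈ Finset.range n, w m (N.cell m x) with ha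
  have hcell : ∀ n m x y, m ≤ n → N.cell n x = N.cell n y → N.cell m x = N.cell m y := by
    intro n m x y hmn
    induction hmn with
    | refl => exact id
    | step _ ih => exact fun h => ih (N.nested _ _ _ h)
  have ha_congr : ∀ n x y, N.cell n x = N.cell n y → a n x = a n y := fun n x y h =>
    Finset.sum_congr rfl fun m hm => by rw [hcell n m x y (Finset.mem_range.1 hm).le h]
  have ha_succ : ∀ n x, a (n + 1) x = a n x + w n (N.cell n x) := fun n x =>
    Finset.sum_range_succ _ _
  set C : ℝ → Set (ℕ × J) := fun θ => {p | ∃ x, N.cell p.1 x = p.2 ∧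
    a p.1 x ≤ ENNReal.ofReal θ ∧ ENNReal.ofReal θ < a p.1 x + w p.1 p.2} with hC
  have hcov : ∀ θ ∈ Ico (0 : ℝ) 1, ∀ x ∈ A, ∃ n, (n, N.cell n x) ∈ C θ := by
    intro θ hθ x hx
    have h1 : ENNReal.ofReal θ < ∑' n, w n (N.cell n x) :=
      (ENNReal.ofReal_lt_one.2 hθ.2).trans_le (hw x hx)
    have hex : ∃ n, ENNReal.ofReal θ < a n x :=
      ((ENNReal.tendsto_nat_tsum _).eventually_const_lt h1).exists
    obtain ⟨m, hm⟩ : ∃ m, Nat.find hex = m + 1 := by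
      refine Nat.exists_eq_succ_of_ne_zero fun h0 => ?_
      have := Nat.find_spec hex
      simp [h0, ha] at this
    refine ⟨m, x, rfl, not_lt.1 (Nat.find_min hex (by omega)), ?_⟩
    rw [← ha_succ]
    exact hm ▸ Nat.find_spec hex
  have hset : ∀ p : ℕ × J, MeasurableSet {θ | p ∈ C θ} ∧
      volume.restrict (Ico (0 : ℝ) 1) {θ | p ∈ C θ} ≤ w p.1 p.2 := by
    rintro ⟨n, j⟩
    by_cases hj : ∃ x, N.cell n x = j
    · obtain ⟨x, rfl⟩ := hj
      have heq : {θ | (n, N.cell n x) ∈ C θ} =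
          ENNReal.ofReal ⁻¹' Ico (a n x) (a n x + w n (N.cell n x)) := by
        ext θ
        constructor
        · rintro ⟨y, hy, h1, h2⟩
          rw [ha_congr n y x hy] at h1 h2
          exact ⟨h1, h2⟩
        · exact fun h => ⟨x, rfl, h⟩
      have hmeas : MeasurableSet {θ | (n, N.cell n x) ∈ C θ} := by
        rw [heq]
        exact ENNReal.measurable_ofReal measurableSet_Ico
      refine ⟨hmeas, ?_⟩
      rw [Measure.restrict_apply hmeas, heq]
      set b := w n (N.cell n x)
      rcases eq_or_ne b ∞ with hb | hb
      · simp [hb]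
      rcases eq_or_ne (a n x) ∞ with hax | hax
      · simp [hax]
      calc volume (ENNReal.ofReal ⁻¹' Ico (a n x) (a n x + b) ∩ Ico 0 1)
          ≤ volume (Ico (a n x).toReal ((a n x).toReal + b.toReal)) := by
            refine measure_mono ?_
            rintro θ ⟨⟨h1, h2⟩, h3, -⟩
            refine ⟨ENNReal.toReal_le_of_le_ofReal h3 h1, ?_⟩
            rw [← ENNReal.toReal_add hax hb]
            exact (ENNReal.ofReal_lt_iff_lt_toReal h3 (by finiteness)).1 h2
        _ = b := by simp [hb]
    · have : {θ | (n, j) ∈ C θ} = ∅ := by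
        ext θ
        simp only [mem_ofPred_eq, mem_empty_iff_false, iff_false]
        rintro ⟨x, hx, -⟩
        exact hj ⟨x, hx⟩
      simp [this]
  set g : ℝ → ℝ≥0∞ := fun θ => ∑' p : ℕ × J, (C θ).indicator (fun p => (2⁻¹ ^ p.1) ^ s) p
  have hind : ∀ p : ℕ × J, (fun θ => (C θ).indicator (fun p => ((2 : ℝ≥0∞)⁻¹ ^ p.1) ^ s) p) =
      {θ | p ∈ C θ}.indicator fun _ => ((2 : ℝ≥0∞)⁻¹ ^ p.1) ^ s := by
    intro p
    ext θ
    simp [indicator]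
  have hmeas : ∀ p : ℕ × J,
      Measurable fun θ => (C θ).indicator (fun p => ((2 : ℝ≥0∞)⁻¹ ^ p.1) ^ s) p := fun p => by
    rw [hind p]
    exact measurable_const.indicator (hset p).1
  have hint : ∫⁻ θ in Ico (0 : ℝ) 1, g θ ≤ ∑' n, ∑' j, w n j * (2⁻¹ ^ n) ^ s := by
    rw [lintegral_tsum fun p => (hmeas p).aemeasurable,
      ← ENNReal.tsum_prod (f := fun n j => w n j * ((2 : ℝ≥0∞)⁻¹ ^ n) ^ s)]
    refine ENNReal.tsum_le_tsum fun p => ?_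
    rw [hind p, lintegral_indicator_const (hset p).1, mul_comm]
    gcongr
    exact (hset p).2
  have : IsProbabilityMeasure (volume.restrict (Ico (0 : ℝ) 1)) := ⟨by simp⟩
  obtain ⟨θ, hθ, hle⟩ := exists_notMem_null_le_lintegral
    (μ := volume.restrict (Ico (0 : ℝ) 1)) (N := (Ico (0 : ℝ) 1)ᶜ)
    (Measurable.tsum (L := .unconditional _) hmeas).aemeasurable (by simp)
  exact ⟨C θ, hcov θ (not_not.1 hθ), hle.trans hint⟩

variable (N s) in
/-- `weightedContent` as an outer measure, to be compared with the metric outer measure that defines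
`μH[s]`. -/
noncomputable def weightedOuterMeasure : OuterMeasure X where
  measureOf := N.weightedContent s
  empty := weightedContent_empty
  mono := weightedContent_mono
  iUnion_nat T _ := weightedContent_iUnion_le T

variable [MeasurableSpace X] [BorelSpace X]

/-- Every Hausdorff null set is null for the weighted content: the weighted content is an outer measure
bounded by a multiple of `diam ^ s` on sets of small diameter. -/
theorem weightedContent_eq_zero (hs : 0 < s) (hA : μH[s] A = 0) : N.weightedContent s A = 0 := by
  have hc : ((N.multiplicity : ℝ≥0) + 1) * 2 ^ s ≠ 0 := by positivity
  have key : N.weightedOuterMeasure s ≤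
      OuterMeasure.mkMetric ((((N.multiplicity : ℝ≥0) + 1) * 2 ^ s) • fun r : ℝ≥0∞ => r ^ s) := by
    refine OuterMeasure.le_mkMetric _ _ 1 one_pos fun T hT => ?_
    refine (weightedContent_le_ediam hs hT).trans ?_
    simp only [Pi.smul_apply, ENNReal.smul_def, smul_eq_mul]
    gcongr
    push_cast
    rw [ENNReal.coe_rpow_of_nonneg _ hs.le]
    gcongr
    · exact le_self_add
    · simp
  rw [OuterMeasure.mkMetric_nnreal_smul _ hc] at key
  have := key A
  rw [smul_apply, OuterMeasure.coe_mkMetric] at this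
  change _ ≤ _ • μH[s] A at this
  rw [hA, smul_zero] at this
  exact le_antisymm this zero_le

/-- A cover by cells of small total cost uses small cells only, as `s > 0`, so it bounds the Hausdorff
measure. -/
theorem hausdorffMeasure_eq_zero [Countable J] (hs : 0 < s) (hA : N.weightedContent s A = 0) :
    μH[s] A = 0 := by
  classical
  have hpos : ∀ m : ℕ, 0 < ((2 : ℝ≥0∞)⁻¹ ^ m) ^ s := fun m =>
    ENNReal.rpow_pos (ENNReal.pow_pos (by simp) m) (by finiteness)
  have hex : ∀ m : ℕ, ∃ C : Set (ℕ × J), (∀ x ∈ A, ∃ n, (n, N.cell n x) ∈ C) ∧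
      ∑' p : ℕ × J, C.indicator (fun p => ((2 : ℝ≥0∞)⁻¹ ^ p.1) ^ s) p ≤ (2⁻¹ ^ m) ^ s := by
    intro m
    obtain ⟨w, hw, hcost⟩ := exists_weight_of_weightedContent_lt (hA.trans_lt (hpos m))
    obtain ⟨C, hC, hCw⟩ := exists_cover_of_weight (s := s) hw
    exact ⟨C, hC, hCw.trans hcost.le⟩
  choose C hC hcost using hex
  set t : ℕ → ℕ × J → Set X := fun m p => {x | N.cell p.1 x = p.2 ∧ p ∈ C m} with ht
  have hdiam : ∀ m p, Metric.ediam (t m p) ^ s ≤ (C m).indicator (fun p => (2⁻¹ ^ p.1) ^ s) p := by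
    intro m p
    by_cases hp : p ∈ C m
    · rw [indicator_of_mem hp]
      gcongr
      exact Metric.ediam_le fun x hx y hy => N.edist_le _ _ _ (hx.1.trans hy.1.symm)
    · have : t m p = ∅ := by ext; simp [ht, hp]
      simp [this, hs]
  have hlim := ENNReal.tendsto_pow_atTop_nhds_zero_of_lt_one (r := 2⁻¹) (by simp)
  refine le_antisymm ((Measure.hausdorffMeasure_le_liminf_tsum s A _ hlim t ?_ ?_).trans ?_)
    zero_le
  · refine Eventually.of_forall fun m p => ?_
    rw [← ENNReal.rpow_le_rpow_iff hs]
    exact (hdiam m p).trans ((ENNReal.le_tsum p).trans (hcost m))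
  · refine Eventually.of_forall fun m x hx => ?_
    obtain ⟨n, hn⟩ := hC m x hx
    exact mem_iUnion.2 ⟨(n, N.cell n x), rfl, hn⟩
  · rw [← (tendsto_dyadic_rpow hs).liminf_eq]
    exact liminf_le_liminf (Eventually.of_forall fun m =>
      (ENNReal.tsum_le_tsum (hdiam m)).trans (hcost m))

theorem weightedContent_ne_zero_of_lt_dimH [Countable J] {s : ℝ≥0} (hs : 0 < s)
    (hA : s < dimH A) : N.weightedContent s A ≠ 0 := fun h => by
  have h1 := hausdorffMeasure_of_lt_dimH hA
  rw [hausdorffMeasure_eq_zero (NNReal.coe_pos.2 hs) h] at h1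
  exact ENNReal.zero_ne_top h1

end Content

/-! ### Contents of products -/

section Product

variable {X Y J L : Type*} [EMetricSpace X] [EMetricSpace Y]

/-- The partitions of a product into products of cells of equal level. -/
def prod (M : DyadicNet X J) (N : DyadicNet Y L) : DyadicNet (X × Y) (J × L) where
  cell n p := (M.cell n p.1, N.cell n p.2)
  nested n x y h := by
    rw [Prod.mk.injEq] at h ⊢
    exact ⟨M.nested _ _ _ h.1, N.nested _ _ _ h.2⟩
  edist_le n x y h := by
    rw [Prod.mk.injEq] at h
    exact max_le (M.edist_le _ _ _ h.1) (N.edist_le _ _ _ h.2)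
  multiplicity := M.multiplicity * N.multiplicity
  encard_image_le n T hT := by
    have h1 := M.encard_image_le n (Prod.fst '' T)
      ((by simpa using LipschitzWith.prod_fst.ediam_image_le T : _ ≤ Metric.ediam T).trans hT)
    have h2 := N.encard_image_le n (Prod.snd '' T)
      ((by simpa using LipschitzWith.prod_snd.ediam_image_le T : _ ≤ Metric.ediam T).trans hT)
    calc _ ≤ ((M.cell n '' (Prod.fst '' T)) ×ˢ (N.cell n '' (Prod.snd '' T))).encard := by
          refine encard_le_encard ?_
          rintro _ ⟨p, hp, rfl⟩
          exact ⟨mem_image_of_mem _ (mem_image_of_mem _ hp),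
            mem_image_of_mem _ (mem_image_of_mem _ hp)⟩
      _ ≤ _ := by
          rw [encard_prod]
          push_cast
          gcongr

variable {M : DyadicNet X J} {N : DyadicNet Y L} {s t : ℝ} {A : Set X} {B : Set Y}

theorem dyadic_rpow_add (n : ℕ) :
    ((2 : ℝ≥0∞)⁻¹ ^ n) ^ (s + t) = (2⁻¹ ^ n) ^ t * (2⁻¹ ^ n) ^ s := by
  rw [add_comm s, ENNReal.rpow_add _ _ (by simp) (by finiteness)]

/-- Weighted contents are supermultiplicative. Given a weighted cover `W` of `A ×ˢ B` and `x ∈ A`, the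
weights `W (cell x × ·)` cover `B`, so their cost is at least `c`; as a function of `cell x`
this cost is `c` times a weighted cover of `A`. -/
theorem mul_weightedContent_le {c : ℝ≥0∞} (hc : c ≠ ∞) (hcB : c ≤ N.weightedContent t B) :
    c * M.weightedContent s A ≤ (M.prod N).weightedContent (s + t) (A ×ˢ B) := by
  rcases eq_or_ne c 0 with rfl | hc0
  · simp
  refine le_iInf₂ fun W hW => ?_
  set v : ℕ → J → ℝ≥0∞ := fun n j => ∑' l, W n (j, l) * (2⁻¹ ^ n) ^ t with hv
  have hcov : ∀ x ∈ A, c ≤ ∑' n, v n (M.cell n x) := fun x hx =>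
    hcB.trans (weightedContent_le (fun n l => W n (M.cell n x, l)) fun y hy => hW (x, y) ⟨hx, hy⟩)
  have hA : M.weightedContent s A ≤ c⁻¹ * ∑' n, ∑' j, v n j * (2⁻¹ ^ n) ^ s := by
    refine (weightedContent_le (fun n j => c⁻¹ * v n j) fun x hx => ?_).trans_eq ?_
    · rw [ENNReal.tsum_mul_left, ← ENNReal.inv_mul_cancel hc0 hc]
      gcongr
      exact hcov x hx
    · simp_rw [mul_assoc, ENNReal.tsum_mul_left]
  calc c * M.weightedContent s A
      ≤ c * (c⁻¹ * ∑' n, ∑' j, v n j * (2⁻¹ ^ n) ^ s) := by gcongr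
    _ = ∑' n, ∑' p : J × L, W n p * (2⁻¹ ^ n) ^ (s + t) := by
        rw [← mul_assoc, ENNReal.mul_inv_cancel hc0 hc, one_mul]
        refine tsum_congr fun n => ?_
        rw [ENNReal.tsum_prod']
        simp_rw [hv, dyadic_rpow_add, ← mul_assoc, ENNReal.tsum_mul_right]

/-- If `B` is covered by at most `2^{nt}` cells of level `n` for every `n`, then a weighted cover of `A`,
spread over these cells, covers `A ×ˢ B` at the same cost with exponent `s + t`. -/
theorem weightedContent_prod_le (S : ℕ → Finset L) (hS : ∀ n, ∀ y ∈ B, N.cell n y ∈ S n)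
    (hcard : ∀ n, (S n).card * ((2 : ℝ≥0∞)⁻¹ ^ n) ^ t ≤ 1) :
    (M.prod N).weightedContent (s + t) (A ×ˢ B) ≤ M.weightedContent s A := by
  classical
  refine le_iInf₂ fun w hw => ?_
  refine (weightedContent_le (fun n p => if p.2 ∈ S n then w n p.1 else 0) ?_).trans ?_
  · rintro ⟨x, y⟩ ⟨hx, hy⟩
    simpa [prod, hS _ y hy] using hw x hx
  · refine ENNReal.tsum_le_tsum fun n => ?_
    rw [ENNReal.tsum_prod']
    refine ENNReal.tsum_le_tsum fun j => ?_
    calc ∑' l, (if l ∈ S n then w n j else 0) * ((2 : ℝ≥0∞)⁻¹ ^ n) ^ (s + t)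
        = w n j * ((S n).card * (2⁻¹ ^ n) ^ t * (2⁻¹ ^ n) ^ s) := by
          rw [ENNReal.tsum_mul_right, tsum_eq_sum (s := S n) (by simp +contextual),
            Finset.sum_congr rfl fun l hl => if_pos hl, Finset.sum_const, nsmul_eq_mul,
            dyadic_rpow_add]
          ring
      _ ≤ w n j * (1 * (2⁻¹ ^ n) ^ s) := by gcongr; exact hcard n
      _ = _ := by rw [one_mul]

end Product

/-! ### Dyadic cubes -/

section Pi

variable (ι : Type*) [Fintype ι]

/-- The half-open dyadic cubes of `ι → ℝ`, a cube of level `n` being labelled by `⌊2ⁿ x⌋`. -/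
noncomputable def pi : DyadicNet (ι → ℝ) (ι → ℤ) where
  cell n x i := ⌊x i * 2 ^ n⌋
  nested n x y h := by
    funext i
    have h := congrFun h i
    simp only [pow_succ, ← mul_assoc] at h
    -- The cube of level `n` is read off from the one of level `n + 1` by halving the label.
    have key : ∀ a : ℝ, ⌊a⌋ = ⌊a * 2⌋ / 2 := fun a => by
      simpa using Int.floor_div_natCast (a * 2) 2
    rw [key, h, ← key]
  edist_le n x y h := by
    refine edist_pi_le_iff.2 fun i => ?_
    have h1 := Int.abs_sub_lt_one_of_floor_eq_floor (congrFun h i)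
    rw [edist_dist, Real.dist_eq, ← sub_mul, abs_mul, abs_of_pos (by positivity : (0 : ℝ) < 2 ^ n)]
      at *
    refine ENNReal.ofReal_le_of_le_toReal ?_
    simp only [ENNReal.toReal_pow, ENNReal.toReal_inv, ENNReal.toReal_ofNat]
    rw [inv_pow, ← one_div, le_div_iff₀ (by positivity)]
    exact h1.le
  multiplicity := 3 ^ Fintype.card ι
  encard_image_le n T hT := by
    classical
    rcases T.eq_empty_or_nonempty with rfl | ⟨x, hx⟩
    · simp
    calc _ ≤ ((Fintype.piFinset fun i =>
          Finset.Icc (⌊x i * 2 ^ n⌋ - 1) (⌊x i * 2 ^ n⌋ + 1) : Finset (ι → ℤ)) :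
            Set (ι → ℤ)).encard := by
          refine encard_le_encard ?_
          rintro _ ⟨y, hy, rfl⟩
          rw [Finset.mem_coe, Fintype.mem_piFinset]
          intro i
          have h := (edist_le_pi_edist x y i).trans ((Metric.edist_le_ediam_of_mem hx hy).trans hT)
          rw [edist_dist, Real.dist_eq] at h
          have h := ENNReal.toReal_mono (by finiteness) h
          rw [ENNReal.toReal_ofReal (abs_nonneg _)] at h
          simp only [ENNReal.toReal_pow, ENNReal.toReal_inv, ENNReal.toReal_ofNat] at h
          have h2 : (0 : ℝ) < 2 ^ n := by positivity
          rw [inv_pow, ← one_div, le_div_iff₀ h2] at h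
          have h : |x i * 2 ^ n - y i * 2 ^ n| ≤ 1 := by
            rwa [← sub_mul, abs_mul, abs_of_pos h2]
          rw [abs_le] at h
          rw [Finset.mem_Icc, sub_le_iff_le_add, ← Int.floor_add_one, ← Int.floor_add_one]
          exact ⟨Int.floor_le_floor (by linarith), Int.floor_le_floor (by linarith)⟩
      _ = _ := by
          have h3 : ∀ z : ℤ, (Finset.Icc (z - 1) (z + 1)).card = 3 := fun z => by
            rw [Int.card_Icc]
            omega
          rw [encard_coe_eq_coe_finsetCard, Fintype.card_piFinset]
          simp [h3]

end Pi

end DyadicNet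

/-! ### Hausdorff dimension of products -/

section Products

open DyadicNet Module

theorem dimH_add_le_dimH_prod_pi {ι κ : Type*} [Fintype ι] [Fintype κ] {A : Set (ι → ℝ)}
    {B : Set (κ → ℝ)} (hA : A.Nonempty) (hB : B.Nonempty) :
    dimH A + dimH B ≤ dimH (A ×ˢ B) := by
  rcases eq_or_ne (dimH A) 0 with hA0 | hA0
  · rw [hA0, zero_add]
    nth_rw 1 [← snd_image_prod hA B]
    exact LipschitzWith.prod_snd.dimH_image_le _
  rcases eq_or_ne (dimH B) 0 with hB0 | hB0
  · rw [hB0, add_zero]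
    nth_rw 1 [← fst_image_prod A hB]
    exact LipschitzWith.prod_fst.dimH_image_le _
  refine le_of_forall_lt fun x hx => ?_
  obtain ⟨a, ha, b, hb, hab⟩ := ENNReal.exists_lt_add_of_lt_add hx hA0 hB0
  obtain ⟨s, has, hsA⟩ := ENNReal.lt_iff_exists_nnreal_btwn.1 ha
  obtain ⟨t, hbt, htB⟩ := ENNReal.lt_iff_exists_nnreal_btwn.1 hb
  have hs : 0 < s := ENNReal.coe_pos.1 (pos_of_gt has)
  have ht : 0 < t := ENNReal.coe_pos.1 (pos_of_gt hbt)
  refine (hab.trans (ENNReal.add_lt_add has hbt)).trans_le ?_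
  rw [← ENNReal.coe_add]
  refine le_dimH_of_hausdorffMeasure_ne_zero fun h0 => ?_
  have h := weightedContent_eq_zero (N := (DyadicNet.pi ι).prod (DyadicNet.pi κ))
    (NNReal.coe_pos.2 (add_pos hs ht)) h0
  have hA' := weightedContent_ne_zero_of_lt_dimH (N := DyadicNet.pi ι) hs hsA
  have hB' := weightedContent_ne_zero_of_lt_dimH (N := DyadicNet.pi κ) ht htB
  have hle := mul_weightedContent_le (M := DyadicNet.pi ι) (N := DyadicNet.pi κ) (s := s) (t := t)
    (A := A) (c := min 1 ((DyadicNet.pi κ).weightedContent t B)) (by simp) (min_le_right _ _)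
  rw [← NNReal.coe_add, h, nonpos_iff_eq_zero, mul_eq_zero] at hle
  refine hle.elim (fun h => ?_) hA'
  rcases min_choice 1 ((DyadicNet.pi κ).weightedContent t B) with h' | h'
  · exact one_ne_zero (h'.symm.trans h)
  · exact hB' (h'.symm.trans h)

theorem dimH_prod_univ_pi_le {ι κ : Type*} [Fintype ι] [Fintype κ] (A : Set (ι → ℝ)) :
    dimH (A ×ˢ (univ : Set (κ → ℝ))) ≤ dimH A + Fintype.card κ := by
  classical
  -- Unit cubes, in place of `univ`, have finitely many dyadic cubes of each level.
  set cube : (κ → ℤ) → Set (κ → ℝ) := fun z => {y | ∀ i, ⌊y i⌋ = z i} with hcube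
  have hU : A ×ˢ (univ : Set (κ → ℝ)) = ⋃ z, A ×ˢ cube z := by
    rw [← prod_iUnion]
    congr 1
    exact (eq_univ_of_forall fun y =>
      mem_iUnion.2 ⟨fun i => ⌊y i⌋, show y ∈ cube _ from fun _ => rfl⟩).symm
  rw [hU, dimH_iUnion]
  refine iSup_le fun z => ?_
  refine ENNReal.le_of_forall_pos_le_add fun ε hε hfin => ?_
  set s : ℝ≥0 := (dimH A).toNNReal + ε with hs
  have hs0 : 0 < s := add_pos_of_nonneg_of_pos zero_le hε
  have hdim : dimH A < s := by
    rw [hs, ENNReal.coe_add, ENNReal.coe_toNNReal (Real.dimH_ne_top A)]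
    exact ENNReal.lt_add_right (Real.dimH_ne_top A) (ENNReal.coe_pos.2 hε).ne'
  have hA0 := weightedContent_eq_zero (N := DyadicNet.pi ι) (NNReal.coe_pos.2 hs0)
    (hausdorffMeasure_of_dimH_lt hdim)
  have hprod := weightedContent_prod_le (M := DyadicNet.pi ι) (N := DyadicNet.pi κ) (s := s)
    (t := Fintype.card κ) (A := A) (B := cube z)
    (fun n => Fintype.piFinset fun i => Finset.Ico (z i * 2 ^ n) ((z i + 1) * 2 ^ n)) ?_ ?_
  · rw [hA0, nonpos_iff_eq_zero] at hprod
    have h := hausdorffMeasure_eq_zero (by positivity) hprod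
    have h' : dimH (A ×ˢ cube z) ≤ ((s + Fintype.card κ : ℝ≥0) : ℝ≥0∞) :=
      dimH_le_of_hausdorffMeasure_ne_top (by push_cast; simp [h])
    refine h'.trans_eq ?_
    rw [hs]
    push_cast
    rw [ENNReal.coe_toNNReal (Real.dimH_ne_top A)]
    ring
  · intro n y hy
    rw [Fintype.mem_piFinset]
    intro i
    obtain ⟨h1, h2⟩ := Int.floor_eq_iff.1 (hy i)
    have h3 : (0 : ℝ) < 2 ^ n := by positivity
    rw [Finset.mem_Ico]
    refine ⟨Int.le_floor.2 ?_, Int.floor_lt.2 ?_⟩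
    · push_cast
      gcongr
    · push_cast
      gcongr
  · intro n
    have h3 : ∀ m : ℤ, (Finset.Ico (m * 2 ^ n) ((m + 1) * 2 ^ n)).card = 2 ^ n := fun m => by
      rw [Int.card_Ico, add_mul, one_mul, add_sub_cancel_left]
      exact_mod_cast Int.toNat_natCast (2 ^ n)
    rw [Fintype.card_piFinset, Finset.prod_congr rfl fun i _ => h3 (z i), Finset.prod_const,
      Finset.card_univ, ENNReal.rpow_natCast]
    push_cast
    rw [← mul_pow, ← mul_pow, ENNReal.mul_inv_cancel (by simp) (by simp), one_pow, one_pow]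

/-- Marstrand's product inequality, for arbitrary nonempty sets. -/
theorem dimH_add_le_dimH_prod {V W : Type*} [NormedAddCommGroup V] [NormedSpace ℝ V]
    [FiniteDimensional ℝ V] [NormedAddCommGroup W] [NormedSpace ℝ W] [FiniteDimensional ℝ W]
    {A : Set V} {B : Set W} (hA : A.Nonempty) (hB : B.Nonempty) :
    dimH A + dimH B ≤ dimH (A ×ˢ B) := by
  let e : V ≃L[ℝ] (Fin (finrank ℝ V) → ℝ) := ContinuousLinearEquiv.ofFinrankEq (by simp)
  let f : W ≃L[ℝ] (Fin (finrank ℝ W) → ℝ) := ContinuousLinearEquiv.ofFinrankEq (by simp)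
  have h := dimH_add_le_dimH_prod_pi (hA.image e) (hB.image f)
  rw [prod_image_image_eq] at h
  rw [e.dimH_image, f.dimH_image] at h
  exact h.trans_eq ((e.prodCongr f).dimH_image (A ×ˢ B))

theorem dimH_prod_univ_le {V : Type*} [NormedAddCommGroup V] [NormedSpace ℝ V]
    [FiniteDimensional ℝ V] {κ : Type*} [Fintype κ] (A : Set V) :
    dimH (A ×ˢ (univ : Set (κ → ℝ))) ≤ dimH A + Fintype.card κ := by
  let e : V ≃L[ℝ] (Fin (finrank ℝ V) → ℝ) := ContinuousLinearEquiv.ofFinrankEq (by simp)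
  have h := dimH_prod_univ_pi_le (κ := κ) (e '' A)
  rw [e.dimH_image] at h
  refine le_trans ?_ h
  rw [← (e.prodCongr (ContinuousLinearEquiv.refl ℝ (κ → ℝ))).dimH_image (A ×ˢ univ)]
  refine dimH_mono ?_
  rintro _ ⟨p, hp, rfl⟩
  exact ⟨mem_image_of_mem _ hp.1, mem_univ _⟩

end Products

/-! ### Affinely independent tuples -/

section Tuples

variable {d k n : ℕ} {E : Set (Euc d)}

theorem powSet_nonempty (hE : E.Nonempty) : (powSet E n).Nonempty :=
  ⟨WithLp.toLp 2 fun _ => hE.some, fun _ => hE.some_mem⟩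

theorem dimH_add_dimH_powSet_le (hE : E.Nonempty) :
    dimH E + dimH (powSet E n) ≤ dimH (powSet E (n + 1)) := by
  refine (dimH_add_le_dimH_prod hE (powSet_nonempty hE)).trans ?_
  set f : EucPow d (n + 1) → Euc d × EucPow d n :=
    fun x => (x 0, WithLp.toLp 2 fun i => x i.succ) with hf
  have hsub : E ×ˢ powSet E n ⊆ f '' powSet E (n + 1) := by
    rintro ⟨a, y⟩ ⟨ha, hy⟩
    exact ⟨WithLp.toLp 2 (Fin.cons a y.ofLp), fun i => Fin.cases ha hy i, rfl⟩
  have hsmooth : ContDiff ℝ 1 f := by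
    refine (contDiff_piLp_apply 2).prodMk (contDiff_piLp' 2 fun i => ?_)
    exact contDiff_piLp_apply 2
  exact (dimH_mono hsub).trans
    (hsmooth.contDiffOn.dimH_image_le convex_univ (subset_univ _))

theorem natCast_mul_dimH_le_dimH_powSet (hE : E.Nonempty) (n : ℕ) :
    n * dimH E ≤ dimH (powSet E n) := by
  induction n with
  | zero => simp
  | succ n ih =>
    refine le_trans ?_ (dimH_add_dimH_powSet_le hE)
    push_cast
    rw [add_mul, one_mul, add_comm]
    gcongr

/-- The tuple obtained from `(y, c)` by inserting the linear combination `∑ cᵢ yᵢ` at place `j`. -/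
noncomputable def linearExtension (j : Fin (n + 1)) (p : EucPow d n × (Fin n → ℝ)) : EucPow d (n + 1) :=
  WithLp.toLp 2 (j.insertNth (∑ i, p.2 i • p.1 i) p.1.ofLp)

theorem contDiff_linearExtension (j : Fin (n + 1)) :
    ContDiff ℝ 1 (linearExtension (d := d) j) := by
  refine contDiff_piLp' 2 fun i => ?_
  have happ : ∀ i, ContDiff ℝ 1 fun p : EucPow d n × (Fin n → ℝ) => p.1 i := fun i =>
    (contDiff_piLp_apply 2).comp contDiff_fst
  induction i using j.succAboveCases with
  | x =>
    simp only [linearExtension, Fin.insertNth_apply_same]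
    exact ContDiff.sum fun i _ => ((contDiff_apply ℝ ℝ i).comp contDiff_snd).smul (happ i)
  | p i =>
    simp only [linearExtension, Fin.insertNth_apply_succAbove]
    exact happ i

/-- Affinely dependent tuples are linearly dependent, so that one entry is a linear combination of the
others. Linear combinations suffice, although affine ones would save a dimension. -/
theorem exists_linearExtension_eq {x : EucPow d (n + 1)} (hx : x ∈ powSet E (n + 1))
    (hdep : ¬ AffineIndependent ℝ x.ofLp) :
    ∃ j, x ∈ linearExtension j '' (powSet E n ×ˢ univ) := by
  have hlin : ¬ LinearIndependent ℝ x.ofLp := fun h => hdep h.affineIndependent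
  obtain ⟨g, hg, j, hj⟩ := Fintype.not_linearIndependent_iff.1 hlin
  refine ⟨j, (WithLp.toLp 2 fun i => x (j.succAbove i), fun i => -(g j)⁻¹ * g (j.succAbove i)),
    ⟨fun i => hx _, mem_univ _⟩, ?_⟩
  rw [Fin.sum_univ_succAbove _ j] at hg
  refine (WithLp.ofLp_injective 2) (funext fun i => ?_)
  induction i using j.succAboveCases with
  | x =>
    simp only [linearExtension, Fin.insertNth_apply_same, mul_smul, ← Finset.smul_sum]
    rw [← neg_eq_of_add_eq_zero_right hg, smul_neg, neg_smul, neg_neg, inv_smul_smul₀ hj]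
  | p i => simp [linearExtension]

theorem dimH_affineDependent_le :
    dimH {x ∈ powSet E (n + 1) | ¬ AffineIndependent ℝ x.ofLp} ≤ dimH (powSet E n) + n := by
  refine (dimH_mono fun x hx => mem_iUnion.2 (exists_linearExtension_eq hx.1 hx.2)).trans ?_
  rw [dimH_iUnion]
  refine iSup_le fun j => ?_
  refine ((contDiff_linearExtension j).contDiffOn.dimH_image_le convex_univ
    (subset_univ _)).trans ?_
  simpa using dimH_prod_univ_le (κ := Fin n) (powSet E n)

/-- The affinely dependent tuples have dimension at most `dim Eⁿ + n < dim Eⁿ + dim E ≤ dim Eⁿ⁺¹`. -/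
theorem dimH_affineIndependent_eq (hE : (n : ℝ≥0∞) < dimH E) :
    dimH {x ∈ powSet E (n + 1) | AffineIndependent ℝ x.ofLp} = dimH (powSet E (n + 1)) := by
  have hne : E.Nonempty := nonempty_iff_ne_empty.2 fun h => by simp [h] at hE
  have hunion : powSet E (n + 1) = {x ∈ powSet E (n + 1) | AffineIndependent ℝ x.ofLp} ∪
      {x ∈ powSet E (n + 1) | ¬ AffineIndependent ℝ x.ofLp} := by
    ext x
    simp only [mem_union, mem_ofPred_eq]
    tauto
  have hlt : dimH {x ∈ powSet E (n + 1) | ¬ AffineIndependent ℝ x.ofLp} <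
      dimH (powSet E (n + 1)) := by
    refine dimH_affineDependent_le.trans_lt (lt_of_lt_of_le ?_ (dimH_add_dimH_powSet_le hne))
    rw [add_comm]
    exact ENNReal.add_lt_add_right (Real.dimH_ne_top _) hE
  have h := dimH_union {x ∈ powSet E (n + 1) | AffineIndependent ℝ x.ofLp}
    {x ∈ powSet E (n + 1) | ¬ AffineIndependent ℝ x.ofLp}
  rw [← hunion] at h
  rcases le_total (dimH {x ∈ powSet E (n + 1) | AffineIndependent ℝ x.ofLp})
    (dimH {x ∈ powSet E (n + 1) | ¬ AffineIndependent ℝ x.ofLp}) with h' | h'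
  · rw [max_eq_right h'] at h
    exact absurd h.le hlt.not_ge
  · rw [max_eq_left h'] at h
    exact h.symm

end Tuples

/-! ### Essential suprema under bi-Lipschitz maps -/

section EssSup

variable {X Y : Type*} [MetricSpace X] [MeasurableSpace X] [BorelSpace X]
  [MetricSpace Y] [MeasurableSpace Y] [BorelSpace Y]

theorem hausdorffMeasure_image_pos_iff {K K' : ℝ≥0} {Φ : X → Y} (hΦ : LipschitzWith K Φ)
    (hΦ' : AntilipschitzWith K' Φ) {α : ℝ} (hα : 0 ≤ α) (A : Set X) :
    0 < μH[α] (Φ '' A) ↔ 0 < μH[α] A := by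
  have h1 := hΦ.hausdorffMeasure_image_le hα A
  have h2 := hΦ'.le_hausdorffMeasure_image hα A
  simp only [pos_iff_ne_zero, ne_eq, not_iff_not]
  constructor
  · intro h
    simpa [h] using h2
  · intro h
    simpa [h] using h1

theorem preEssSup_le_image {K K' : ℝ≥0} {Φ : X → Y} (hΦ : LipschitzWith K Φ)
    (hΦ' : AntilipschitzWith K' Φ) {α : ℝ} (hα : 0 ≤ α) {A : Set X} {f : X → ℝ≥0∞}
    {g : Y → ℝ≥0∞} (hfg : ∀ x ∈ A, f x ≤ g (Φ x)) :
    preEssSup α A f ≤ preEssSup α (Φ '' A) g := by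
  refine iSup_mono fun q => iSup_mono' fun hq => ⟨?_, le_rfl⟩
  refine ((hausdorffMeasure_image_pos_iff hΦ hΦ' hα _).2 hq).trans_le (measure_mono ?_)
  rintro _ ⟨x, ⟨hx, hqx⟩, rfl⟩
  exact ⟨mem_image_of_mem _ hx, hqx.trans_le (hfg x hx)⟩

theorem hausdorffEssSup_le_image {K K' : ℝ≥0} {Φ : X → Y} (hΦ : LipschitzWith K Φ)
    (hΦ' : AntilipschitzWith K' Φ) {α : ℝ} (hα : 0 ≤ α) {A : Set X} (hA : A.Nonempty)
    {f : X → ℝ≥0∞} {g : Y → ℝ≥0∞} (hfg : ∀ x ∈ A, f x ≤ g (Φ x)) :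
    hausdorffEssSup α A f ≤ hausdorffEssSup α (Φ '' A) g := by
  unfold hausdorffEssSup
  by_cases h : 0 < μH[α] A
  · rw [if_pos h, if_pos ((hausdorffMeasure_image_pos_iff hΦ hΦ' hα A).2 h)]
    exact preEssSup_le_image hΦ hΦ' hα hfg
  · rw [if_neg h, if_neg (mt (hausdorffMeasure_image_pos_iff hΦ hΦ' hα A).1 h)]
    -- `μH[0]` is positive on nonempty sets. Hence `α - ε ≥ 0` for small `ε`, as the Lipschitz bounds need.
    have hα0 : 0 < α := by
      refine hα.lt_of_ne fun h0 => h ?_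
      obtain ⟨x, hx⟩ := hA
      rw [← h0]
      exact ((by simp : 0 < μH[(0 : ℝ)] {x})).trans_le (measure_mono (singleton_subset_iff.2 hx))
    refine le_of_tendsto_of_tendsto (tendsto_preEssSup α A f) (tendsto_preEssSup α _ g) ?_
    filter_upwards [Ioo_mem_nhdsGT hα0] with ε hε
    exact preEssSup_le_image hΦ hΦ' (sub_nonneg.2 hε.2.le) hfg

end EssSup

/-! ### The map `W ↦ Wⁿ` is bi-Lipschitz -/

namespace AffineGrassmannian

variable {V : Type*} [NormedAddCommGroup V] [InnerProductSpace ℝ V] [FiniteDimensional ℝ V] {k n : ℕ}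

theorem mem_orthogonal_direction_powPlane (W : AffineGrassmannian V k)
    {v : PiLp 2 fun _ : Fin n => V} (hv : ∀ i, v i ∈ W.plane.directionᗮ) :
    v ∈ (powPlane W.plane n).directionᗮ := by
  rw [Submodule.mem_orthogonal]
  intro u hu
  rw [PiLp.inner_apply]
  exact Finset.sum_eq_zero fun i _ => Submodule.inner_right_of_mem_orthogonal
    ((mem_direction_powPlane W.nonempty u).1 hu i) (hv i)

theorem proj_pow_apply (W : AffineGrassmannian V k) (v : PiLp 2 fun _ : Fin n => V) (i : Fin n) :
    (W.pow n).proj v i = W.proj (v i) := by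
  have h : (W.pow n).proj v = WithLp.toLp 2 fun i => W.proj (v i) := by
    refine Submodule.eq_starProjection_of_mem_orthogonal (K := (powPlane W.plane n).direction)
      (v := WithLp.toLp 2 fun i => W.proj (v i)) ?_ ?_
    · exact (mem_direction_powPlane W.nonempty _).2 fun i =>
        Submodule.starProjection_apply_mem _ _
    · exact W.mem_orthogonal_direction_powPlane fun i =>
        Submodule.sub_starProjection_mem_orthogonal _
  rw [h]

theorem foot_pow_apply (W : AffineGrassmannian V k) (i : Fin n) : (W.pow n).foot i = W.foot := by
  have h : (W.pow n).foot = WithLp.toLp 2 fun _ => W.foot := by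
    refine EuclideanGeometry.coe_orthogonalProjection_eq_iff_mem.2 ⟨fun i => ?_, ?_⟩
    · exact EuclideanGeometry.orthogonalProjection_mem _
    · exact W.mem_orthogonal_direction_powPlane fun i =>
        EuclideanGeometry.vsub_orthogonalProjection_mem_direction_orthogonal _ _
  rw [h]

theorem dist_def (W W' : AffineGrassmannian V k) :
    dist W W' = ‖W.proj - W'.proj‖ + ‖W.foot - W'.foot‖ := rfl

theorem norm_foot_pow_sub (W W' : AffineGrassmannian V k) :
    ‖(W.pow n).foot - (W'.pow n).foot‖ = √n * ‖W.foot - W'.foot‖ := by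
  rw [PiLp.norm_eq_of_L2]
  simp only [PiLp.sub_apply, foot_pow_apply, Finset.sum_const, Finset.card_univ, Fintype.card_fin,
    nsmul_eq_mul]
  rw [Real.sqrt_mul (by positivity), Real.sqrt_sq (norm_nonneg _)]

theorem norm_proj_pow_sub_le (W W' : AffineGrassmannian V k) :
    ‖(W.pow n).proj - (W'.pow n).proj‖ ≤ ‖W.proj - W'.proj‖ := by
  refine ContinuousLinearMap.opNorm_le_bound _ (norm_nonneg _) fun v => ?_
  refine le_of_sq_le_sq ?_ (by positivity)
  rw [mul_pow, PiLp.norm_sq_eq_of_L2, PiLp.norm_sq_eq_of_L2, Finset.mul_sum]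
  refine Finset.sum_le_sum fun i _ => ?_
  rw [← mul_pow]
  gcongr
  rw [sub_apply, PiLp.sub_apply, proj_pow_apply, proj_pow_apply]
  exact (W.proj - W'.proj).le_opNorm (v i)

theorem norm_proj_sub_le (hn : 0 < n) (W W' : AffineGrassmannian V k) :
    ‖W.proj - W'.proj‖ ≤ ‖(W.pow n).proj - (W'.pow n).proj‖ := by
  refine ContinuousLinearMap.opNorm_le_bound _ (norm_nonneg _) fun v => ?_
  set u : PiLp 2 fun _ : Fin n => V := PiLp.single 2 ⟨0, hn⟩ v
  have h := ((W.pow n).proj - (W'.pow n).proj).le_opNorm u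
  rw [PiLp.norm_single] at h
  refine le_trans ?_ h
  refine le_trans ?_ (PiLp.norm_apply_le _ ⟨0, hn⟩)
  rw [sub_apply, sub_apply, PiLp.sub_apply, proj_pow_apply, proj_pow_apply]
  simp [u]

theorem lipschitzWith_pow : LipschitzWith (1 + NNReal.sqrt n)
    fun W : AffineGrassmannian V k => W.pow n := by
  refine LipschitzWith.of_dist_le_mul fun W W' => ?_
  rw [dist_def, dist_def, norm_foot_pow_sub]
  push_cast
  have h := norm_proj_pow_sub_le (n := n) W W'
  have h1 := norm_nonneg (W.proj - W'.proj)
  have h2 := norm_nonneg (W.foot - W'.foot)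
  nlinarith [mul_nonneg (Real.sqrt_nonneg n) h1]

theorem antilipschitzWith_pow (hn : 0 < n) : AntilipschitzWith 1
    fun W : AffineGrassmannian V k => W.pow n := by
  refine AntilipschitzWith.of_le_mul_dist fun W W' => ?_
  rw [dist_def, dist_def, norm_foot_pow_sub, NNReal.coe_one, one_mul]
  have h1 : (1 : ℝ) ≤ √n := Real.one_le_sqrt.2 (by exact_mod_cast hn)
  have h2 := norm_nonneg (W.foot - W'.foot)
  nlinarith [norm_proj_sub_le hn W W']

end AffineGrassmannian

/-! ### Fibres of the incidence set and the dimension bound -/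

section Incidence

variable {d k : ℕ} {E : Set (Euc d)}

theorem fst_image_incidenceSet : Prod.fst '' incidenceSet E k = spannedPlanes E k := by
  ext W
  constructor
  · rintro ⟨_, ⟨x, hx, hxE, rfl⟩, rfl⟩
    exact ⟨x, hx, hxE, rfl⟩
  · rintro ⟨x, hx, hxE, rfl⟩
    exact ⟨_, ⟨x, hx, hxE, rfl⟩, rfl⟩

theorem dimH_affineIndependent_le_incidenceSet :
    dimH {x ∈ powSet E (k + 1) | AffineIndependent ℝ x.ofLp} ≤ dimH (incidenceSet E k) := by
  refine le_trans (dimH_mono ?_) (LipschitzWith.prod_snd.dimH_image_le _)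
  rintro x ⟨hxE, hx⟩
  exact ⟨_, ⟨x, hx, hxE, rfl⟩, rfl⟩

theorem dimH_fiber_le (W : AffineGrassmannian (Euc d) k) :
    dimH (Prod.fst ⁻¹' {W} ∩ incidenceSet E k) ≤
      dimH (powSet E (k + 1) ∩ ((W.pow (k + 1)).plane : Set (EucPow d (k + 1)))) := by
  refine le_trans (dimH_mono ?_) ((LipschitzWith.prodMk_left W).dimH_image_le _)
  rintro _ ⟨hW, x, hx, hxE, rfl⟩
  obtain rfl := mem_singleton_iff.1 hW
  exact ⟨x, ⟨hxE, fun i => subset_affineSpan ℝ _ (mem_range_self i)⟩, rfl⟩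

end Incidence

theorem theorem1p9 (d k : ℕ) (hk : 1 ≤ k) (hkd : k + 1 ≤ d) (s : ℝ) (E : Set (Euc d))
    (hE : MeasurableSet E) (hks : (k : ℝ) < s) (hs : ENNReal.ofReal s < dimH E)
    (hFubini : FubiniProperty (incidenceSet E k))
    (hSlices : hausdorffEssSup (dimH (spannedPlanes E k)).toReal (diagonalPlanes E k)
        (fun Z => dimH (powSet E (k + 1) ∩ (Z.plane : Set (EucPow d (k + 1))))) ≤
      ENNReal.ofReal
        (max 0 ((dimH (powSet E (k + 1))).toReal - ((k : ℝ) + 1) * ((d : ℝ) - k)))) :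
    ENNReal.ofReal (((k : ℝ) + 1) * min s ((d : ℝ) - k)) ≤ dimH (spannedPlanes E k) := by
  have hkE : (k : ℝ≥0∞) < dimH E := by
    refine lt_of_le_of_lt ?_ hs
    rw [← ENNReal.ofReal_natCast]
    exact ENNReal.ofReal_le_ofReal hks.le
  have hne : E.Nonempty := nonempty_iff_ne_empty.2 fun h => by simp [h] at hkE
  obtain ⟨hS, hdim⟩ := hFubini
  rw [fst_image_incidenceSet] at hdim
  have hP : (spannedPlanes E k).Nonempty := fst_image_incidenceSet (E := E) ▸ hS.image _
  have hess := (hausdorffEssSup_le_image (A := spannedPlanes E k)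
    (AffineGrassmannian.lipschitzWith_pow (n := k + 1))
    (AffineGrassmannian.antilipschitzWith_pow k.succ_pos)
    (ENNReal.toReal_nonneg (a := dimH (spannedPlanes E k))) hP
    (g := fun Z => dimH (powSet E (k + 1) ∩ (Z.plane : Set (EucPow d (k + 1)))))
    fun W _ => dimH_fiber_le (E := E) W).trans hSlices
  have hD : dimH (powSet E (k + 1)) ≤ dimH (incidenceSet E k) :=
    dimH_affineIndependent_eq hkE ▸ dimH_affineIndependent_le_incidenceSet
  have htop : dimH (powSet E (k + 1)) ≠ ∞ := Real.dimH_ne_top _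
  have hlow : ((k : ℝ) + 1) * s ≤ (dimH (powSet E (k + 1))).toReal := by
    rw [← ENNReal.ofReal_le_iff_le_toReal htop]
    refine le_trans ?_ (natCast_mul_dimH_le_dimH_powSet hne (k + 1))
    rw [ENNReal.ofReal_mul (by positivity)]
    gcongr
    exact_mod_cast (ENNReal.ofReal_natCast (k + 1)).le
  rcases eq_or_ne (dimH (spannedPlanes E k)) ∞ with hβ | hβ
  · simp [hβ]
  have hmain : dimH (powSet E (k + 1)) ≤ dimH (spannedPlanes E k) + ENNReal.ofReal
      (max 0 ((dimH (powSet E (k + 1))).toReal - ((k : ℝ) + 1) * ((d : ℝ) - k))) :=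
    (hD.trans_eq hdim).trans (by gcongr)
  have hreal := ENNReal.toReal_mono (by finiteness) hmain
  rw [ENNReal.toReal_add hβ (by finiteness), ENNReal.toReal_ofReal (le_max_left _ _)] at hreal
  rw [ENNReal.ofReal_le_iff_le_toReal hβ]
  have hk0 : (0 : ℝ) ≤ (k : ℝ) + 1 := by positivity
  rcases max_cases 0 ((dimH (powSet E (k + 1))).toReal - ((k : ℝ) + 1) * ((d : ℝ) - k)) with h | h
  · rw [h.1] at hreal
    have := mul_le_mul_of_nonneg_left (min_le_left s ((d : ℝ) - k)) hk0
    linarith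
  · rw [h.1] at hreal
    have := mul_le_mul_of_nonneg_left (min_le_right s ((d : ℝ) - k)) hk0
    linarith
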